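/- Let $d\ge 2$ and let $\mathbb{T}_d$ be the $(d+1)$-regular tree. For a probability measure $\pi$ on $\{0,1,2,\dots\}$, the frog model on $\mathbb{T}_d$ with i.i.d.-$\pi$ initial conditions starts with one active particle at a designated vertex $\rho$ (the root) and, at each vertex $v\neq\rho$, a number $\eta(v)$ of sleeping particles, where the $\eta(v)$ are independent with law $\pi$. Active particles perform independent simple random walks, and whenever an active particle visits a vertex, all particles sleeping there become active. A realization is called transient if $\rho$ is not visited infinitely often by active particles. Fix $\mu>0$ and, for integers $N\ge \max(1,\mu)$, let $\pi_N=\frac{\mu}{N}\delta_N+\bigl(1-\frac{\mu}{N}\bigr)\delta_0$. Then there are integers $N_1,N_2,\dots\ge\max(1,\mu)$ such that, for independent random variables $X_n$ with $X_n\sim\pi_{N_n}$, the sum $X=\sum_{n=1}^\infty X_n$ is almost surely finite, its law $\pi$ has infinite mean, and the frog model on $\mathbb{T}_d$ with i.i.d.-$\pi$ initial conditions is almost surely transient. -/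

import Mathlib

open MeasureTheory ProbabilityTheory
open scoped ENNReal

namespace FrogModel

/-- The law `(μ / N) δ_N + (1 - μ / N) δ_0` on the natural numbers
(a probability measure as soon as `0 ≤ μ ≤ N` and `0 < N`). -/
noncomputable def islandLaw (μ : ℝ) (N : ℕ) : Measure ℕ :=
  ENNReal.ofReal (μ / N) • Measure.dirac N + ENNReal.ofReal (1 - μ / N) • Measure.dirac 0

/-- The law on `[0, ∞]` of `∑ n, X n`, where `X 0, X 1, ...` are independent and `X n` has law
`ν n`, each `ν n` being a probability measure on the natural numbers. -/
noncomputable def indepSumLaw (ν : ℕ → Measure ℕ) : Measure ℝ≥0∞ :=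
  (Measure.infinitePi ν).map (fun x : ℕ → ℕ => ∑' n, (x n : ℝ≥0∞))

variable {V : Type*}

open Classical in
/-- Number of particles initially at `v`: a single particle (the active one) at the starting
site `ρ`, and `η v` sleeping particles at every other site `v`. -/
noncomputable def particleCount (ρ : V) (η : V → ℕ) (v : V) : ℕ :=
  if v = ρ then 1 else η v

/-- The sites whose particles are ever active, in the realization in which the `i`-th particle
(`i = 0, 1, ...`) of site `v` is at `S v i t` after it has made `t` steps.
The particles at `ρ` are active from the beginning, and those at any
other site become active once an active particle visits that site. -/
inductive Activated (ρ : V) (η : V → ℕ) (S : V → ℕ → ℕ → V) : V → Prop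
  | start : Activated ρ η S ρ
  | visit {u : V} (i t : ℕ) (hu : Activated ρ η S u) (hi : i < particleCount ρ η u) :
      Activated ρ η S (S u i t)

/-- The set of all visits to the site `x` by active particles: `(v, i, t)` stands for the visit
of the `i`-th particle of `v` to `x` at its `t`-th step. -/
def visits (ρ : V) (η : V → ℕ) (S : V → ℕ → ℕ → V) (x : V) : Set (V × ℕ × ℕ) :=
  {p | Activated ρ η S p.1 ∧ p.2.1 < particleCount ρ η p.1 ∧ S p.1 p.2.1 p.2.2 = x}

/-- A realization is transient if the starting site is not visited infinitely often. -/
def IsTransient (ρ : V) (η : V → ℕ) (S : V → ℕ → ℕ → V) : Prop :=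
  (visits ρ η S ρ).Finite

variable [MeasurableSpace V] {Ω : Type*} [MeasurableSpace Ω]

open Classical in
/-- `X` is a simple random walk on `G` started at `v`, under `P`. -/
structure IsSimpleRandomWalk (G : SimpleGraph V) [G.LocallyFinite] (v : V) (P : Measure Ω)
    (X : Ω → ℕ → V) : Prop where
  measurable : Measurable X
  path_prob : ∀ (n : ℕ) (x : ℕ → V), P {ω | ∀ k ≤ n, X ω k = x k} =
    if x 0 = v ∧ ∀ k < n, G.Adj (x k) (x (k + 1)) then
      ∏ k ∈ Finset.range n, (G.degree (x k) : ℝ≥0∞)⁻¹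
    else 0

/-- `(S, η)` is a frog model on `G` with i.i.d.-`π` initial conditions: the counts `η v` are
i.i.d. with law `π`, the paths `S v i` are independent simple random walks, `S v i` starting at
`v`, and the counts are independent of the paths. -/
structure IsFrogModel (G : SimpleGraph V) [G.LocallyFinite] (π : Measure ℕ) (P : Measure Ω)
    (η : V → Ω → ℕ) (S : V → ℕ → Ω → ℕ → V) : Prop where
  measurable_count : ∀ v, Measurable (η v)
  law_count : ∀ v, P.map (η v) = π
  indep_count : iIndepFun η P
  walk : ∀ v i, IsSimpleRandomWalk G v P (S v i)
  indep_walk : iIndepFun (fun (p : V × ℕ) => S p.1 p.2) P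
  indep_count_walk : IndepFun (fun ω v => η v ω) (fun ω (p : V × ℕ) => S p.1 p.2 ω) P

end FrogModel

/-!
The proof is a first moment computation. Let `A` be the adjacency operator of the `(d + 1)`-regular
tree. If a site is activated and one of its particles returns to the root `ρ`, then there is a chain
of distinct sites `ρ = u₀, u₁, …, uₙ, uₙ₊₁ = ρ` in which some particle of each `uᵢ` visits `uᵢ₊₁`
(`Activated.exists_chain`). If almost surely only finitely many chains do this, then only finitely
many particles ever reach `ρ`, and each of them does so finitely often because the simple random
walk on the tree is transient (`isTransient_of_finite`). So it is enough that the probabilities of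
the chains have a finite sum.

Since the sites of a chain are distinct, its steps are independent, and the walk started at `u`
visits `v` with probability at most `2 d⁻ⁿ`, where `n = dist u v`
(`IsSimpleRandomWalk.tsum_measure_eq_le`). The probability that one of `k` particles does so is
therefore at most `min 1 (2 k d⁻ⁿ) ≤ (2 k) ^ (3 / 4) (d ^ (-3 / 4)) ^ n`. Put `s = d ^ (-1 / 4)`.
Then a chain has probability at most a constant times `Mⁿ ∏ (s ^ 3) ^ dist uᵢ uᵢ₊₁`, where `M` is the
moment `E (2 X) ^ (3 / 4)` of the number `X` of particles per site. The kernel `(s ^ 3) ^ dist u v`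
multiplies the weight `w v = (s ^ 2) ^ dist ρ v` by at most a constant `C` depending on `d` only
(`sum_pow_dist_mul_pow_dist_le`): up to a factor it is the resolvent of `A` at `d s³ + s⁻³`, a point
strictly beyond `2 √d = 2 s⁻²`, and `A w ≤ 2 √d w`. Hence the sum over all chains is finite as soon
as `M C ≤ 1 / 2` (`tsum_chainWeight_le`), and the model is then transient
(`IsFrogModel.ae_isTransient`).

It remains to observe that `M` can be small although the mean is infinite. By subadditivity of
`x ↦ x ^ (3 / 4)`, `M` is at most the sum of the moments `(μ / Nₙ) (2 Nₙ) ^ (3 / 4)` of the separate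
terms, each of which is as small as desired for large `Nₙ`, while every term has mean `μ`. The same
bound makes the probabilities `μ / Nₙ` summable, so that the sum of the terms is almost surely finite
by the Borel-Cantelli lemma.
-/

namespace FrogModel

/-! ### Eigenfunctions of the adjacency operator of a regular tree -/

variable {V : Type*} {G : SimpleGraph V}

lemma exists_adj_dist_add_one (hG : G.Connected) {u x : V} (h : x ≠ u) :
    ∃ y, G.Adj x y ∧ G.dist u y + 1 = G.dist u x := by
  obtain ⟨p, hp⟩ := hG.exists_walk_length_eq_dist x u
  cases p with
  | nil => exact absurd rfl h
  | @cons _ y _ hadj q =>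
    refine ⟨y, hadj, ?_⟩
    have h1 := SimpleGraph.dist_le q
    have h2 : G.dist u x ≤ G.dist u y + G.dist y x := hG.dist_triangle
    rw [SimpleGraph.dist_eq_one_iff_adj.2 hadj.symm] at h2
    rw [SimpleGraph.Walk.length_cons, SimpleGraph.dist_comm] at hp
    rw [SimpleGraph.dist_comm] at h1
    omega

lemma eq_of_adj_of_dist_add_one (hG : G.IsTree) {u x y z : V} (hy : G.Adj x y) (hz : G.Adj x z)
    (hdy : G.dist u y + 1 = G.dist u x) (hdz : G.dist u z + 1 = G.dist u x) : y = z := by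
  obtain ⟨p, hp⟩ := hG.connected.exists_walk_length_eq_dist u y
  obtain ⟨q, hq⟩ := hG.connected.exists_walk_length_eq_dist u z
  have hp' : (p.concat hy.symm).IsPath :=
    SimpleGraph.Walk.isPath_of_length_eq_dist _ (by simp [hp, hdy])
  have hq' : (q.concat hz.symm).IsPath :=
    SimpleGraph.Walk.isPath_of_length_eq_dist _ (by simp [hq, hdz])
  have := (hG.existsUnique_path u x).unique hp' hq'
  simpa using congrArg SimpleGraph.Walk.penultimate this

variable [G.LocallyFinite] {d : ℕ}

/-- On the `(d + 1)`-regular tree `x ↦ s ^ dist u x` is an eigenfunction of the adjacency operator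
away from `u`: one neighbour of `x` is closer to `u` than `x` is and `d` are farther away. -/
lemma sum_neighbors_pow_dist (hG : G.IsTree) (hreg : G.IsRegularOfDegree (d + 1)) {s : ℝ}
    (hs : 0 < s) {u x : V} (h : x ≠ u) :
    ∑ y ∈ G.neighborFinset x, s ^ G.dist u y = (d * s + s⁻¹) * s ^ G.dist u x := by
  classical
  obtain ⟨y₀, hy₀, hd₀⟩ := exists_adj_dist_add_one hG.connected h
  have hmem : y₀ ∈ G.neighborFinset x := by simpa using hy₀
  have hfar : ∀ y ∈ (G.neighborFinset x).erase y₀, s ^ G.dist u y = s ^ (G.dist u x + 1) := by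
    intro y hy
    rw [Finset.mem_erase, SimpleGraph.mem_neighborFinset] at hy
    rcases hG.dist_eq_dist_add_one_of_adj u hy.2 with h1 | h1
    · exact absurd (eq_of_adj_of_dist_add_one hG hy.2 hy₀ h1.symm hd₀) hy.1
    · rw [h1]
  rw [← Finset.add_sum_erase _ _ hmem, Finset.sum_congr rfl hfar, Finset.sum_const,
    Finset.card_erase_of_mem hmem, SimpleGraph.card_neighborFinset_eq_degree, hreg.degree_eq,
    ← hd₀]
  simp only [add_tsub_cancel_right, nsmul_eq_mul]
  field_simp
  ring

lemma sum_neighbors_pow_dist_self (hreg : G.IsRegularOfDegree (d + 1)) (s : ℝ) (u : V) :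
    ∑ y ∈ G.neighborFinset u, s ^ G.dist u y = (d + 1) * s := by
  have : ∀ y ∈ G.neighborFinset u, s ^ G.dist u y = s := by
    intro y hy
    rw [SimpleGraph.mem_neighborFinset] at hy
    rw [SimpleGraph.dist_eq_one_iff_adj.2 hy, pow_one]
  rw [Finset.sum_congr rfl this, Finset.sum_const, SimpleGraph.card_neighborFinset_eq_degree,
    hreg.degree_eq]
  simp

lemma sum_neighbors_pow_dist_le (hG : G.IsTree) (hreg : G.IsRegularOfDegree (d + 1)) {s : ℝ}
    (hs : 0 < s) (hs1 : s ≤ 1) (u x : V) :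
    ∑ y ∈ G.neighborFinset x, s ^ G.dist u y ≤ (d * s + s⁻¹) * s ^ G.dist u x := by
  rcases eq_or_ne x u with rfl | h
  · rw [sum_neighbors_pow_dist_self hreg, SimpleGraph.dist_self, pow_zero]
    have := one_le_inv₀ hs |>.2 hs1
    linarith
  · exact (sum_neighbors_pow_dist hG hreg hs h).le

/-- A weighted Schur test on the tree. The kernel `c⁻¹ * (s ^ 3) ^ dist u x`, with
`c = s⁻³ - s³`, inverts `β - A`, where `A` is the adjacency operator and `β = d s³ + s⁻³`; the
weight `(s ^ 2) ^ dist ρ x` satisfies `A w ≤ α w` with `α = 2 s⁻² < β`. Comparing the two at the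
place where the ratio of the left side to the weight is (nearly) maximal gives the bound. -/
lemma sum_pow_dist_mul_pow_dist_le (hG : G.IsTree) (hreg : G.IsRegularOfDegree (d + 1)) {s : ℝ}
    (hs : 0 < s) (hs1 : s < 1) (hds : d * s ^ 4 = 1) (ρ : V) (U : Finset V) (x : V) :
    ∑ u ∈ U, (s ^ 3) ^ G.dist u x * (s ^ 2) ^ G.dist ρ u ≤
      (1 - s ^ 6) / (1 - s) ^ 2 * (s ^ 2) ^ G.dist ρ x := by
  classical
  set w : V → ℝ := fun x => (s ^ 2) ^ G.dist ρ x with hw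
  set F : V → ℝ := fun x => ∑ u ∈ U, (s ^ 3) ^ G.dist u x * w u with hF
  have hwpos : ∀ x, 0 < w x := fun x => by positivity
  have hα : ∀ x, ∑ y ∈ G.neighborFinset x, w y ≤ 2 / s ^ 2 * w x := by
    intro x
    refine (sum_neighbors_pow_dist_le hG hreg (by positivity)
      (pow_le_one₀ hs.le hs1.le) ρ x).trans_eq ?_
    congr 1
    field_simp
    linear_combination hds
  have hβ : ∀ x, (1 / s + 1 / s ^ 3) * F x ≤
      ∑ y ∈ G.neighborFinset x, F y + (1 / s ^ 3 - s ^ 3) * w x := by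
    intro x
    have hc : 0 ≤ 1 / s ^ 3 - s ^ 3 := by
      have : s ^ 3 ≤ 1 := pow_le_one₀ hs.le hs1.le
      have : 1 ≤ 1 / s ^ 3 := by rw [le_div_iff₀ (by positivity)]; linarith
      linarith
    have key : ∀ u, (1 / s + 1 / s ^ 3) * ((s ^ 3) ^ G.dist u x * w u) =
        ∑ y ∈ G.neighborFinset x, (s ^ 3) ^ G.dist u y * w u +
          if u = x then (1 / s ^ 3 - s ^ 3) * w x else 0 := by
      intro u
      rw [← Finset.sum_mul]
      split_ifs with h
      · subst h
        rw [sum_neighbors_pow_dist_self hreg, SimpleGraph.dist_self]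
        field_simp
        linear_combination -s ^ 2 * w u * hds
      · rw [sum_neighbors_pow_dist hG hreg (by positivity) (Ne.symm h)]
        field_simp
        linear_combination -(s ^ 2) * (s ^ 3) ^ G.dist u x * w u * hds
    simp only [hF]
    rw [Finset.mul_sum, Finset.sum_congr rfl fun u _ => key u, Finset.sum_add_distrib,
      Finset.sum_comm]
    gcongr
    rw [Finset.sum_ite_eq']
    split_ifs
    · exact le_rfl
    · exact mul_nonneg hc (hwpos x).le
  -- The ratio `F / w` is bounded since `U` is finite and `s ^ 3 ≤ s ^ 2`.
  have hbdd : BddAbove (Set.range fun x => F x / w x) := by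
    refine ⟨U.card, ?_⟩
    rintro _ ⟨x, rfl⟩
    simp only [hF]
    rw [div_le_iff₀ (hwpos x), ← nsmul_eq_mul]
    refine Finset.sum_le_card_nsmul _ _ _ fun u _ => ?_
    have h1 : (s ^ 3) ^ G.dist u x ≤ (s ^ 2) ^ G.dist u x :=
      pow_le_pow_left₀ (by positivity) (pow_le_pow_of_le_one hs.le hs1.le (by norm_num)) _
    calc (s ^ 3) ^ G.dist u x * w u ≤ (s ^ 2) ^ G.dist u x * (s ^ 2) ^ G.dist ρ u :=
          mul_le_mul_of_nonneg_right h1 (hwpos u).le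
      _ = (s ^ 2) ^ (G.dist ρ u + G.dist u x) := by rw [← pow_add, add_comm]
      _ ≤ w x := pow_le_pow_of_le_one (by positivity) (pow_le_one₀ hs.le hs1.le)
          hG.connected.dist_triangle
  have hFm : ∀ x, F x ≤ (⨆ x, F x / w x) * w x := fun x =>
    (div_le_iff₀ (hwpos x)).1 (le_ciSup hbdd x)
  set m := ⨆ x, F x / w x with hm
  have hFpos : ∀ x, 0 ≤ F x := fun x =>
    Finset.sum_nonneg fun u _ => mul_nonneg (by positivity) (hwpos u).le
  have hm0 : 0 ≤ m := Real.iSup_nonneg fun x => div_nonneg (hFpos x) (hwpos x).le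
  have hβpos : 0 < 1 / s + 1 / s ^ 3 := by positivity
  have hmle : m ≤ (2 / s ^ 2 * m + (1 / s ^ 3 - s ^ 3)) / (1 / s + 1 / s ^ 3) := by
    have : Nonempty V := ⟨x⟩
    refine ciSup_le fun x => ?_
    rw [div_le_div_iff₀ (hwpos x) hβpos]
    calc F x * (1 / s + 1 / s ^ 3) ≤ ∑ y ∈ G.neighborFinset x, F y + (1 / s ^ 3 - s ^ 3) * w x := by
          rw [mul_comm]; exact hβ x
      _ ≤ m * (2 / s ^ 2 * w x) + (1 / s ^ 3 - s ^ 3) * w x := by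
          gcongr
          refine (Finset.sum_le_sum fun y _ => hFm y).trans ?_
          rw [← Finset.mul_sum]
          exact mul_le_mul_of_nonneg_left (hα x) hm0
      _ = _ := by ring
  refine (hFm x).trans (mul_le_mul_of_nonneg_right ?_ (hwpos x).le)
  rw [le_div_iff₀ hβpos] at hmle
  rw [le_div_iff₀ (by have : 0 < 1 - s := by linarith
                      positivity)]
  have h3 : 0 < s ^ 3 := by positivity
  have e1 : m * (1 / s + 1 / s ^ 3) * s ^ 3 = m * (s ^ 2 + 1) := by field_simp
  have e2 : (2 / s ^ 2 * m + (1 / s ^ 3 - s ^ 3)) * s ^ 3 = 2 * s * m + (1 - s ^ 6) := by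
    field_simp
  have := mul_le_mul_of_nonneg_right hmle h3.le
  rw [e1, e2] at this
  linarith

end FrogModel

namespace FrogModel

/-! ### The Green function of the simple random walk -/

variable {V : Type*} {G : SimpleGraph V}

lemma countable_of_connected [G.LocallyFinite] (hG : G.Connected) : Countable V := by
  obtain ⟨u⟩ := hG.nonempty
  have hsph : ∀ n, {x | G.dist u x = n}.Countable := by
    intro n
    induction n with
    | zero =>
      refine (Set.countable_singleton u).mono fun x hx => ?_
      exact (hG.dist_eq_zero_iff.1 hx).symm
    | succ n ih =>
      refine (ih.biUnion fun y _ => (Set.toFinite (G.neighborSet y)).countable).mono fun x hx => ?_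
      have hx' : G.dist u x = n + 1 := hx
      have hne : x ≠ u := by
        rintro rfl
        simp at hx'
      obtain ⟨y, hy, hyd⟩ := exists_adj_dist_add_one hG hne
      simp only [Set.mem_iUnion]
      exact ⟨y, by simpa using (by omega : G.dist u y = n), hy.symm⟩
  rw [← Set.countable_univ_iff]
  exact (Set.countable_iUnion hsph).mono fun x _ => Set.mem_iUnion.2 ⟨G.dist u x, rfl⟩

variable [G.LocallyFinite] {d : ℕ}

open Classical in
/-- The function `x ↦ 2 d⁻ⁿ`, `n = dist v x`, dominates the Green function of the simple random
walk at `v`: it exceeds its own average over the neighbours by at least the indicator of `v`. -/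
lemma average_add_indicator_le (hG : G.IsTree) (hreg : G.IsRegularOfDegree (d + 1)) (hd : 2 ≤ d)
    {q : ℝ} (hq : d * q = 1) (v x : V) :
    (if x = v then 1 else 0) + ∑ y ∈ G.neighborFinset x,
        ((d + 1 : ℕ) : ℝ≥0∞)⁻¹ * ENNReal.ofReal (2 * q ^ G.dist v y) ≤
      ENNReal.ofReal (2 * q ^ G.dist v x) := by
  have hd' : (2 : ℝ) ≤ d := by exact_mod_cast hd
  have hq0 : 0 < q := by
    by_contra h
    nlinarith
  have hinv : ((d + 1 : ℕ) : ℝ≥0∞)⁻¹ = ENNReal.ofReal ((d + 1 : ℝ)⁻¹) := by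
    rw [ENNReal.ofReal_inv_of_pos (by positivity)]
    congr 1
    rw [show (d + 1 : ℝ) = ((d + 1 : ℕ) : ℝ) by push_cast; rfl, ENNReal.ofReal_natCast]
  have hind : (if x = v then (1 : ℝ≥0∞) else 0) = ENNReal.ofReal (if x = v then 1 else 0) := by
    split_ifs <;> simp
  rw [← Finset.mul_sum, ← ENNReal.ofReal_sum_of_nonneg (fun _ _ => by positivity), hinv,
    ← ENNReal.ofReal_mul (by positivity), hind, ← ENNReal.ofReal_add (by split_ifs <;> norm_num)
      (by positivity), ← Finset.mul_sum]
  refine ENNReal.ofReal_le_ofReal ?_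
  split_ifs with h
  · subst h
    rw [sum_neighbors_pow_dist_self hreg, SimpleGraph.dist_self]
    have : (d + 1 : ℝ)⁻¹ * (2 * ((d + 1) * q)) = 2 * q := by field_simp
    rw [this]
    nlinarith
  · rw [sum_neighbors_pow_dist hG hreg hq0 h, hq, show q⁻¹ = d by field_simp; linarith]
    refine le_of_eq ?_
    field_simp
    ring

variable [MeasurableSpace V] {Ω : Type*} [MeasurableSpace Ω] {P : Measure Ω} {X : Ω → ℕ → V}
  {u : V}

open Classical in
lemma IsSimpleRandomWalk.path_prob_of_regular (hX : IsSimpleRandomWalk G u P X)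
    (hreg : G.IsRegularOfDegree (d + 1)) (n : ℕ) (x : ℕ → V) :
    P {ω | ∀ k ≤ n, X ω k = x k} =
      if x 0 = u ∧ ∀ k < n, G.Adj (x k) (x (k + 1)) then ((d + 1 : ℕ) : ℝ≥0∞)⁻¹ ^ n else 0 := by
  rw [hX.path_prob]
  simp only [hreg.degree_eq, Finset.prod_const, Finset.card_range]

open Classical in
lemma IsSimpleRandomWalk.path_prob_update (hX : IsSimpleRandomWalk G u P X)
    (hreg : G.IsRegularOfDegree (d + 1)) (n : ℕ) (x : ℕ → V) (y : V) :
    P {ω | ∀ k ≤ n + 1, X ω k = Function.update x (n + 1) y k} =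
      P {ω | ∀ k ≤ n, X ω k = x k} *
        if G.Adj (x n) y then ((d + 1 : ℕ) : ℝ≥0∞)⁻¹ else 0 := by
  rw [hX.path_prob_of_regular hreg, hX.path_prob_of_regular hreg]
  have hiff : (Function.update x (n + 1) y 0 = u ∧ ∀ k < n + 1,
      G.Adj (Function.update x (n + 1) y k) (Function.update x (n + 1) y (k + 1))) ↔
      (x 0 = u ∧ ∀ k < n, G.Adj (x k) (x (k + 1))) ∧ G.Adj (x n) y := by
    have e : ∀ k < n + 1, Function.update x (n + 1) y k = x k := fun k hk =>
      Function.update_of_ne (by omega) _ _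
    rw [e 0 (by omega), and_assoc]
    refine and_congr_right fun _ => ⟨fun h => ⟨fun k hk => ?_, ?_⟩, fun h k hk => ?_⟩
    · have := h k (by omega)
      rwa [e k (by omega), e (k + 1) (by omega)] at this
    · have := h n (by omega)
      rwa [e n (by omega), Function.update_self] at this
    · rw [e k hk]
      rcases Nat.lt_succ_iff_lt_or_eq.1 hk with hk' | rfl
      · rw [e (k + 1) (by omega)]
        exact h.1 k hk'
      · rw [Function.update_self]
        exact h.2
  simp only [hiff]
  by_cases h1 : x 0 = u ∧ ∀ k < n, G.Adj (x k) (x (k + 1)) <;> by_cases h2 : G.Adj (x n) y <;>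
    simp [h1, h2, pow_succ]

/-- The expected number of visits to `v` from time `n` on, on the event that the walk follows a
given path up to time `n`, is at most `2 d⁻ᵐ` times the probability of that event, where `m` is the
distance from the end of the path to `v`. -/
lemma IsSimpleRandomWalk.sum_measure_path_inter_le [Countable V]
    (hX : IsSimpleRandomWalk G u P X) (hG : G.IsTree)
    (hreg : G.IsRegularOfDegree (d + 1)) (hd : 2 ≤ d) {q : ℝ} (hq : d * q = 1) (v : V) (M : ℕ) :
    ∀ (n : ℕ) (x : ℕ → V), ∑ m ∈ Finset.range M,
        P ({ω | ∀ k ≤ n, X ω k = x k} ∩ {ω | X ω (n + m) = v}) ≤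
      P {ω | ∀ k ≤ n, X ω k = x k} * ENNReal.ofReal (2 * q ^ G.dist v (x n)) := by
  classical
  induction M with
  | zero => simp
  | succ M ih =>
    intro n x
    set C := {ω | ∀ k ≤ n, X ω k = x k} with hC
    set D : V → Set Ω := fun y => {ω | ∀ k ≤ n + 1, X ω k = Function.update x (n + 1) y k} with hD
    have h0 : P (C ∩ {ω | X ω (n + 0) = v}) ≤ P C * (if x n = v then 1 else 0) := by
      split_ifs with h
      · rw [mul_one]
        exact measure_mono Set.inter_subset_left
      · have he : C ∩ {ω | X ω (n + 0) = v} = ∅ := by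
          ext ω
          simp only [hC, Set.mem_inter_iff, Set.mem_ofPred_eq, add_zero, Set.mem_empty_iff_false,
            iff_false, not_and]
          intro h1 h2
          exact h ((h1 n le_rfl).symm.trans h2)
        rw [he]
        simp
    have hsub : ∀ m, C ∩ {ω | X ω (n + (m + 1)) = v} ⊆
        ⋃ y, D y ∩ {ω | X ω (n + 1 + m) = v} := by
      rintro m ω ⟨h1, h2⟩
      simp only [Set.mem_iUnion]
      refine ⟨X ω (n + 1), fun k hk => ?_, by
        rw [Set.mem_ofPred_eq] at h2 ⊢
        rwa [add_assoc, add_comm 1 m]⟩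
      rcases eq_or_ne k (n + 1) with rfl | hne
      · rw [Function.update_self]
      · rw [Function.update_of_ne hne]
        exact h1 k (by omega)
    rw [Finset.sum_range_succ', add_comm]
    calc _ ≤ P C * (if x n = v then 1 else 0) +
          ∑ m ∈ Finset.range M, ∑' y, P (D y ∩ {ω | X ω (n + 1 + m) = v}) := by
          gcongr with m
          exact (measure_mono (hsub m)).trans (measure_iUnion_le _)
      _ = P C * (if x n = v then 1 else 0) +
          ∑' y, ∑ m ∈ Finset.range M, P (D y ∩ {ω | X ω (n + 1 + m) = v}) := by
          rw [Summable.tsum_finsetSum fun _ _ => ENNReal.summable]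
      _ ≤ P C * (if x n = v then 1 else 0) +
          ∑' y, P C * (if G.Adj (x n) y then ((d + 1 : ℕ) : ℝ≥0∞)⁻¹ else 0) *
            ENNReal.ofReal (2 * q ^ G.dist v y) := by
          gcongr with y
          have := ih (n + 1) (Function.update x (n + 1) y)
          rwa [hX.path_prob_update hreg, Function.update_self] at this
      _ = P C * ((if x n = v then 1 else 0) + ∑ y ∈ G.neighborFinset (x n),
            ((d + 1 : ℕ) : ℝ≥0∞)⁻¹ * ENNReal.ofReal (2 * q ^ G.dist v y)) := by
          rw [mul_add, Finset.mul_sum]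
          congr 1
          rw [tsum_eq_sum (s := G.neighborFinset (x n))]
          · refine Finset.sum_congr rfl fun y hy => ?_
            rw [if_pos (by simpa using hy), mul_assoc]
          · intro y hy
            rw [if_neg (by simpa using hy)]
            simp
      _ ≤ _ := by
          gcongr
          exact average_add_indicator_le hG hreg hd hq v (x n)

/-- Green function bound for the simple random walk on the `(d + 1)`-regular tree. -/
lemma IsSimpleRandomWalk.tsum_measure_eq_le [Countable V] [DiscreteMeasurableSpace V]
    [IsProbabilityMeasure P] (hX : IsSimpleRandomWalk G u P X) (hG : G.IsTree)
    (hreg : G.IsRegularOfDegree (d + 1)) (hd : 2 ≤ d) {q : ℝ} (hq : d * q = 1) (v : V) :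
    ∑' t, P {ω | X ω t = v} ≤ ENNReal.ofReal (2 * q ^ G.dist u v) := by
  have hstart : P {ω | ∀ k ≤ 0, X ω k = u} = 1 := by
    have := hX.path_prob 0 (fun _ => u)
    simpa using this
  have hae : ∀ᵐ ω ∂P, ω ∈ {ω | ∀ k ≤ 0, X ω k = u} := by
    refine (mem_ae_iff_prob_eq_one ?_).2 hstart
    have : {ω | ∀ k ≤ 0, X ω k = u} = (fun ω => X ω 0) ⁻¹' {u} := by
      ext ω
      simp
    rw [this]
    exact (measurable_pi_iff.1 hX.measurable 0) (measurableSet_singleton u)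
  rw [ENNReal.tsum_eq_iSup_nat]
  refine iSup_le fun M => ?_
  have := hX.sum_measure_path_inter_le hG hreg hd hq v M 0 (fun _ => u)
  rw [hstart, one_mul, SimpleGraph.dist_comm] at this
  refine le_trans (Finset.sum_le_sum fun m _ => ?_) this
  refine measure_mono_ae ?_
  filter_upwards [hae] with ω h1 h2
  refine ⟨h1, ?_⟩
  rw [Set.mem_ofPred_eq, zero_add]
  exact h2

end FrogModel

namespace FrogModel

variable {V : Type*}

/-! ### Sums over closed chains of sites -/

/-- The weight of the closed chain `a, l, ρ`: the kernel `K` is evaluated along its steps, and each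
site of `l` contributes a factor `κ`. -/
noncomputable def chainWeight (K : V → V → ℝ≥0∞) (κ : ℝ≥0∞) (ρ : V) : V → List V → ℝ≥0∞
  | a, [] => K a ρ
  | a, b :: l => K a b * (κ * chainWeight K κ ρ b l)

lemma tsum_list (f : List V → ℝ≥0∞) : ∑' l, f l = f [] + ∑' b, ∑' l, f (b :: l) := by
  let e : Unit ⊕ (V × List V) ≃ List V :=
    { toFun := fun o => o.elim (fun _ => []) fun p => p.1 :: p.2
      invFun := fun l => match l with
        | [] => Sum.inl ()
        | b :: l => Sum.inr (b, l)
      left_inv := by rintro (_ | ⟨b, l⟩) <;> rfl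
      right_inv := by rintro (_ | ⟨b, l⟩) <;> rfl }
  have h1 : ∑' o, f (e o) = ∑' l, f l := e.tsum_eq f
  have h2 : ∑' o, f (e o) = ∑' u, f (e (Sum.inl u)) + ∑' p, f (e (Sum.inr p)) :=
    Summable.tsum_sum ENNReal.summable ENNReal.summable
  have h3 : ∑' p : V × List V, f (e (Sum.inr p)) = ∑' b, ∑' l, f (b :: l) :=
    ENNReal.tsum_prod (f := fun b l => f (b :: l))
  rw [← h1, h2, h3, tsum_fintype]
  simp [e]

/-- If `K` multiplies the weight `w` by at most `C` and `κ C ≤ 1 / 2`, then the chains of length `n`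
contribute at most `C 2⁻ⁿ w`. -/
lemma tsum_chainWeight_le {K : V → V → ℝ≥0∞} {κ C : ℝ≥0∞} {ρ : V} {w : V → ℝ≥0∞}
    (hK : ∀ a, ∑' b, K a b * w b ≤ C * w a) (hw : w ρ = 1) (hκ : κ * C ≤ 2⁻¹) (a : V) :
    ∑' l, chainWeight K κ ρ a l ≤ 2 * C * w a := by
  classical
  have htrunc : ∀ (M : ℕ) (a : V),
      ∑' l : List V, (if l.length < M then chainWeight K κ ρ a l else 0) ≤ 2 * C * w a := by
    intro M
    induction M with
    | zero => simp
    | succ M ih =>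
      intro a
      rw [tsum_list]
      have hroot : K a ρ ≤ C * w a := by
        refine le_trans ?_ (hK a)
        simpa [hw] using ENNReal.le_tsum (f := fun b => K a b * w b) ρ
      calc _ = K a ρ + ∑' b, K a b * (κ *
            ∑' l : List V, (if l.length < M then chainWeight K κ ρ b l else 0)) := by
            simp only [← ENNReal.tsum_mul_left]
            simp [chainWeight]
        _ ≤ C * w a + ∑' b, K a b * (κ * (2 * C * w b)) := by
            gcongr with b
            exact ih b
        _ = C * w a + κ * C * 2 * ∑' b, K a b * w b := by
            rw [← ENNReal.tsum_mul_left]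
            congr 1
            exact tsum_congr fun b => by ring
        _ ≤ C * w a + 2⁻¹ * 2 * (C * w a) := by
            gcongr
            exact hK a
        _ = 2 * C * w a := by
            rw [ENNReal.inv_mul_cancel (by norm_num) (by norm_num)]
            ring
  rw [ENNReal.tsum_eq_iSup_sum]
  refine iSup_le fun s => ?_
  refine le_trans ?_ (htrunc (s.sup List.length + 1) a)
  refine le_trans (Finset.sum_le_sum fun l hl => ?_) (ENNReal.sum_le_tsum s)
  rw [if_pos (Nat.lt_succ_of_le (Finset.le_sup hl))]

/-- The steps of a chain without repetitions are the pairs `(x, next x)`, `x` a site of the chain,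
for some function `next`. -/
lemma exists_next [DecidableEq V] (K : V → V → ℝ≥0∞) (κ : ℝ≥0∞) (ρ : V) (l : List V) :
    ∀ a, (a :: l).Nodup → ∃ next : V → V,
      (∀ r : V → V → Prop, (a :: l ++ [ρ]).IsChain r → ∀ x ∈ a :: l, r x (next x)) ∧
      κ ^ l.length * ∏ x ∈ (a :: l).toFinset, K x (next x) = chainWeight K κ ρ a l := by
  induction l with
  | nil =>
    intro a _
    exact ⟨fun _ => ρ, by simp, by simp [chainWeight]⟩
  | cons b l ih =>
    intro a hnd
    obtain ⟨ha, hnd'⟩ := List.nodup_cons.1 hnd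
    obtain ⟨next, h1, h2⟩ := ih b hnd'
    have hne : ∀ x ∈ b :: l, Function.update next a b x = next x := fun x hx =>
      Function.update_of_ne (by rintro rfl; exact ha hx) _ _
    refine ⟨Function.update next a b, fun r hr x hx => ?_, ?_⟩
    · simp only [List.cons_append, List.isChain_cons_cons] at hr
      rcases List.mem_cons.1 hx with rfl | hx
      · rw [Function.update_self]
        exact hr.1
      · rw [hne x hx]
        exact h1 r hr.2 x hx
    · rw [List.toFinset_cons, Finset.prod_insert (by simpa using ha), Function.update_self,
        Finset.prod_congr rfl fun x hx => by rw [hne x (List.mem_toFinset.1 hx)], chainWeight,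
        ← h2, List.length_cons, pow_succ]
      ring

/-- In the realization `(η, S)`, some particle of `u` visits `v` if it is ever activated. -/
def Reaches (ρ : V) (η : V → ℕ) (S : V → ℕ → ℕ → V) (u v : V) : Prop :=
  ∃ i < particleCount ρ η u, ∃ t, S u i t = v

/-- An activated site is the end of a chain of activations without repeated sites. -/
lemma Activated.exists_chain {ρ : V} {η : V → ℕ} {S : V → ℕ → ℕ → V} {v : V}
    (h : Activated ρ η S v) : ∃ L : List V, L.head? = some ρ ∧ L.getLast? = some v ∧ L.Nodup ∧
      L.IsChain (Reaches ρ η S) := by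
  induction h with
  | start => exact ⟨[ρ], by simp⟩
  | @visit u i t hu hi ih =>
    obtain ⟨L, h1, h2, h3, h4⟩ := ih
    by_cases hv : S u i t ∈ L
    · obtain ⟨s, m, rfl⟩ := List.append_of_mem hv
      have hpre : s ++ [S u i t] <+: s ++ S u i t :: m := ⟨m, by simp⟩
      refine ⟨s ++ [S u i t], ?_, by simp, h3.sublist hpre.sublist, h4.prefix hpre⟩
      cases s <;> simpa using h1
    · refine ⟨L ++ [S u i t], by simp [h1], by simp, ?_, ?_⟩
      · rw [List.nodup_append]
        refine ⟨h3, by simp, fun a ha b hb => ?_⟩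
        rw [List.mem_singleton.1 hb]
        rintro rfl
        exact hv ha
      · rw [List.isChain_append]
        refine ⟨h4, by simp, fun x hx y hy => ?_⟩
        rw [h2] at hx
        simp only [Option.mem_def, Option.some.injEq, List.head?_cons] at hx hy
        subst hx hy
        exact ⟨i, hi, t, rfl⟩

/-- If only finitely many chains of activations without repetitions lead from `ρ` back to `ρ`, then
only finitely many activated particles reach `ρ`: each of them starts at the last site of such a
chain. -/
lemma isTransient_of_finite {ρ : V} {η : V → ℕ} {S : V → ℕ → ℕ → V}
    (hfin : {l : List V | (ρ :: l).Nodup ∧ (ρ :: l ++ [ρ]).IsChain (Reaches ρ η S)}.Finite)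
    (hS : ∀ v i, {t | S v i t = ρ}.Finite) : IsTransient ρ η S := by
  set A := {l : List V | (ρ :: l).Nodup ∧ (ρ :: l ++ [ρ]).IsChain (Reaches ρ η S)}
  have hB : ((fun l : List V => (ρ :: l).getLast (by simp)) '' A).Finite := hfin.image _
  refine (hB.biUnion fun v _ => ((Set.finite_lt_nat (particleCount ρ η v)).biUnion fun i _ =>
    (hS v i).image fun t => (v, i, t))).subset ?_
  rintro ⟨v, i, t⟩ ⟨hv, hi, ht⟩
  simp only at hv hi ht
  simp only [Set.mem_iUnion]
  refine ⟨v, ?_, i, hi, t, ht, rfl⟩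
  obtain ⟨L, h1, h2, h3, h4⟩ := hv.exists_chain
  cases L with
  | nil => simp at h1
  | cons a l =>
    obtain rfl : a = ρ := by simpa using h1
    refine ⟨l, ⟨h3, ?_⟩, ?_⟩
    · rw [List.isChain_append]
      refine ⟨h4, by simp, fun x hx y hy => ?_⟩
      rw [h2] at hx
      simp only [Option.mem_def, Option.some.injEq, List.head?_cons] at hx hy
      subst hx hy
      exact ⟨i, hi, t, ht⟩
    · rw [List.getLast?_eq_some_getLast (by simp)] at h2
      simpa using h2

end FrogModel

namespace FrogModel

/-! ### Probability of a chain of activations -/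

/-- Grouping a doubly indexed independent family along the first index gives independent
sequences. -/
lemma iIndepFun_curry {ι κ Ω 𝓧 : Type*} [MeasurableSpace Ω] [MeasurableSpace 𝓧] {P : Measure Ω}
    [IsProbabilityMeasure P] {X : ι × κ → Ω → 𝓧} (hX : ∀ p, Measurable (X p))
    (h : iIndepFun X P) : iIndepFun (fun i ω j => X (i, j) ω) P := by
  have hprob : ∀ p, IsProbabilityMeasure (P.map (X p)) := fun p =>
    Measure.isProbabilityMeasure_map (hX p).aemeasurable
  have hmeas : ∀ i, Measurable fun ω j => X (i, j) ω := fun i =>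
    measurable_pi_iff.2 fun j => hX (i, j)
  rw [iIndepFun_iff_map_fun_eq_infinitePi_map hmeas]
  have hrow : ∀ i, P.map (fun ω j => X (i, j) ω) =
      Measure.infinitePi fun j => P.map (X (i, j)) := fun i =>
    (h.precomp (Prod.mk_right_injective i)).map_fun_eq_infinitePi_map fun j => hX (i, j)
  simp only [hrow]
  rw [← Measure.infinitePi_map_curry (fun i j => P.map (X (i, j)))]
  rw [← h.map_fun_eq_infinitePi_map hX, Measure.map_map (by fun_prop) (measurable_pi_iff.2 hX)]
  rfl

variable {V : Type*} {G : SimpleGraph V} [G.LocallyFinite] {d : ℕ}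
  [MeasurableSpace V] [DiscreteMeasurableSpace V] [Countable V]
  {Ω : Type*} [MeasurableSpace Ω] {P : Measure Ω} [IsProbabilityMeasure P]
  {π : Measure ℕ} {η : V → Ω → ℕ} {S : V → ℕ → Ω → ℕ → V}

/-- Some of the first `c` particles of `x` visits `y` with probability at most
`min 1 (2 c d⁻ⁿ)`, hence at most `(2 c d⁻ⁿ) ^ (3 / 4)`, where `n = dist x y`. -/
lemma IsFrogModel.measure_exists_visit_le (h : IsFrogModel G π P η S) (hG : G.IsTree)
    (hreg : G.IsRegularOfDegree (d + 1)) (hd : 2 ≤ d) {s : ℝ} (hs : 0 < s)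
    (hds : d * s ^ 4 = 1) (x y : V) (c : ℕ) :
    P {ω | ∃ i < c, ∃ t, S x i ω t = y} ≤
      (2 * c : ℝ≥0∞) ^ (3 / 4 : ℝ) * ENNReal.ofReal (s ^ 3) ^ G.dist x y := by
  set n := G.dist x y
  have hunion : P {ω | ∃ i < c, ∃ t, S x i ω t = y} ≤
      2 * c * ENNReal.ofReal (s ^ 4) ^ n := by
    have hsub : {ω | ∃ i < c, ∃ t, S x i ω t = y} ⊆
        ⋃ i ∈ Finset.range c, ⋃ t, {ω | S x i ω t = y} := by
      rintro ω ⟨i, hi, t, ht⟩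
      simp only [Set.mem_iUnion, Finset.mem_range]
      exact ⟨i, hi, t, ht⟩
    calc _ ≤ ∑ i ∈ Finset.range c, ∑' t, P {ω | S x i ω t = y} :=
          (measure_mono hsub).trans <| (measure_biUnion_finset_le _ _).trans <|
            Finset.sum_le_sum fun i _ => measure_iUnion_le _
      _ ≤ ∑ _i ∈ Finset.range c, ENNReal.ofReal (2 * (s ^ 4) ^ n) :=
          Finset.sum_le_sum fun i _ => (h.walk x i).tsum_measure_eq_le hG hreg hd hds y
      _ = _ := by
          rw [Finset.sum_const, Finset.card_range, nsmul_eq_mul,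
            ENNReal.ofReal_mul (by norm_num), ENNReal.ofReal_pow (by positivity),
            ENNReal.ofReal_ofNat]
          ring
  calc P {ω | ∃ i < c, ∃ t, S x i ω t = y}
      ≤ P {ω | ∃ i < c, ∃ t, S x i ω t = y} ^ (3 / 4 : ℝ) := by
        conv_lhs => rw [← ENNReal.rpow_one (P _)]
        exact ENNReal.rpow_le_rpow_of_exponent_ge prob_le_one (by norm_num)
    _ ≤ (2 * c * ENNReal.ofReal (s ^ 4) ^ n) ^ (3 / 4 : ℝ) :=
        ENNReal.rpow_le_rpow hunion (by norm_num)
    _ = _ := by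
        rw [ENNReal.mul_rpow_of_nonneg _ _ (by norm_num)]
        congr 1
        rw [← ENNReal.ofReal_pow (by positivity), ENNReal.ofReal_rpow_of_nonneg (by positivity)
          (by norm_num), ← ENNReal.ofReal_pow (by positivity), ← pow_mul, ← pow_mul,
          ← Real.rpow_natCast, ← Real.rpow_mul hs.le, ← Real.rpow_natCast]
        congr 2
        push_cast
        ring


/-- For fixed counts `e`, the events that `x` reaches `next x`, `x ∈ F`, are independent. -/
lemma IsFrogModel.measure_forall_reaches_le_of_count (h : IsFrogModel G π P η S) (hG : G.IsTree)
    (hreg : G.IsRegularOfDegree (d + 1)) (hd : 2 ≤ d) {s : ℝ} (hs : 0 < s)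
    (hds : d * s ^ 4 = 1) (ρ : V) (e : V → ℕ) (F : Finset V) (next : V → V) :
    P {ω | ∀ x ∈ F, Reaches ρ e (fun v i => S v i ω) x (next x)} ≤
      ∏ x ∈ F, (2 * particleCount ρ e x : ℝ≥0∞) ^ (3 / 4 : ℝ) *
        ENNReal.ofReal (s ^ 3) ^ G.dist x (next x) := by
  have hind : iIndepFun (fun v ω i => S v i ω) P :=
    iIndepFun_curry (fun p => (h.walk p.1 p.2).measurable) h.indep_walk
  set B : V → Set (ℕ → ℕ → V) := fun x =>
    {f | ∃ i < particleCount ρ e x, ∃ t, f i t = next x} with hB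
  have hBm : ∀ x ∈ F, MeasurableSet (B x) := by
    intro x _
    have : B x = ⋃ i ∈ Finset.range (particleCount ρ e x), ⋃ t,
        (fun f : ℕ → ℕ → V => f i t) ⁻¹' {next x} := by
      ext f
      simp [hB]
    rw [this]
    exact Finset.measurableSet_biUnion _ fun i _ => MeasurableSet.iUnion fun t =>
      (by fun_prop : Measurable fun f : ℕ → ℕ → V => f i t) (measurableSet_singleton _)
  have hset : {ω | ∀ x ∈ F, Reaches ρ e (fun v i => S v i ω) x (next x)} =
      ⋂ x ∈ F, (fun ω i => S x i ω) ⁻¹' B x := by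
    ext ω
    simp [hB, Reaches]
  rw [hset, hind.measure_inter_preimage_eq_mul F hBm]
  exact Finset.prod_le_prod' fun x _ =>
    h.measure_exists_visit_le hG hreg hd hs hds x (next x) (particleCount ρ e x)

/-- The bound of `measure_forall_reaches_le_of_count` is integrated over the counts, which are
independent of the paths and of one another. -/
lemma IsFrogModel.measure_forall_reaches_le (h : IsFrogModel G π P η S) (hG : G.IsTree)
    (hreg : G.IsRegularOfDegree (d + 1)) (hd : 2 ≤ d) {s : ℝ} (hs : 0 < s)
    (hds : d * s ^ 4 = 1) (ρ : V) (F : Finset V) (next : V → V) :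
    P {ω | ∀ x ∈ F, Reaches ρ (fun v => η v ω) (fun v i => S v i ω) x (next x)} ≤
      ∏ x ∈ F, (∫⁻ ω, (2 * particleCount ρ (fun v => η v ω) x : ℝ≥0∞) ^ (3 / 4 : ℝ) ∂P) *
        ENNReal.ofReal (s ^ 3) ^ G.dist x (next x) := by
  classical
  have hη : Measurable fun ω v => η v ω := measurable_pi_iff.2 h.measurable_count
  have hS : Measurable fun ω (p : V × ℕ) => S p.1 p.2 ω :=
    measurable_pi_iff.2 fun p => (h.walk p.1 p.2).measurable
  set T : Set ((V → ℕ) × (V × ℕ → ℕ → V)) :=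
    {p | ∀ x ∈ F, Reaches ρ p.1 (fun v i => p.2 (v, i)) x (next x)} with hT
  have hcount : ∀ x, Measurable fun e : V → ℕ => particleCount ρ e x := by
    intro x
    unfold particleCount
    split_ifs <;> fun_prop
  have hTm : MeasurableSet T := by
    have : T = ⋂ x ∈ F, ⋃ i, ({p | i < particleCount ρ p.1 x} ∩
        ⋃ t, (fun p : (V → ℕ) × (V × ℕ → ℕ → V) => p.2 (x, i) t) ⁻¹' {next x}) := by
      ext p
      simp [hT, Reaches]
    rw [this]
    refine Finset.measurableSet_biInter _ fun x _ => MeasurableSet.iUnion fun i =>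
      (measurableSet_lt measurable_const ((hcount x).comp measurable_fst)).inter
      (MeasurableSet.iUnion fun t => ?_)
    exact (by fun_prop : Measurable fun p : (V → ℕ) × (V × ℕ → ℕ → V) => p.2 (x, i) t)
      (measurableSet_singleton _)
  have hlaw := (indepFun_iff_map_prod_eq_prod_map_map hη.aemeasurable hS.aemeasurable).1
    h.indep_count_walk
  have hpre : P {ω | ∀ x ∈ F, Reaches ρ (fun v => η v ω) (fun v i => S v i ω) x (next x)} =
      P.map (fun ω => ((fun v => η v ω), fun p : V × ℕ => S p.1 p.2 ω)) T := by
    rw [Measure.map_apply (hη.prodMk hS) hTm]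
    rfl
  have : IsProbabilityMeasure (P.map fun ω (p : V × ℕ) => S p.1 p.2 ω) :=
    Measure.isProbabilityMeasure_map hS.aemeasurable
  rw [hpre, hlaw, Measure.prod_apply hTm, lintegral_map (measurable_measure_prodMk_left hTm) hη]
  have hindep : iIndepFun (fun x ω =>
      (2 * particleCount ρ (fun v => η v ω) x : ℝ≥0∞) ^ (3 / 4 : ℝ)) P := by
    have := h.indep_count.comp (fun x (k : ℕ) => (2 * ((if x = ρ then 1 else k : ℕ) : ℝ≥0∞)) ^
      (3 / 4 : ℝ)) fun x => measurable_from_top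
    convert this using 3
    simp only [Function.comp_apply, particleCount]
  have hmeas : ∀ x, Measurable fun ω =>
      (2 * particleCount ρ (fun v => η v ω) x : ℝ≥0∞) ^ (3 / 4 : ℝ) := fun x =>
    (measurable_from_top (f := fun k : ℕ => (2 * k : ℝ≥0∞) ^ (3 / 4 : ℝ))).comp
      ((hcount x).comp hη)
  rw [Finset.prod_mul_distrib, ← lintegral_prod_eq_prod_lintegral_of_indepFun F _ hindep hmeas,
    ← lintegral_mul_const _ (Finset.measurable_fun_prod _ fun x _ => hmeas x)]
  refine lintegral_mono fun ω => ?_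
  rw [Measure.map_apply hS (measurable_prodMk_left hTm), ← Finset.prod_mul_distrib]
  exact h.measure_forall_reaches_le_of_count hG hreg hd hs hds ρ _ F next

end FrogModel

namespace FrogModel

/-! ### Transience when the moment of order `3 / 4` is small -/

variable {V : Type*} {G : SimpleGraph V} [G.LocallyFinite] {d : ℕ}

lemma tsum_pow_dist_mul_pow_dist_le (hG : G.IsTree) (hreg : G.IsRegularOfDegree (d + 1)) {s : ℝ}
    (hs : 0 < s) (hs1 : s < 1) (hds : d * s ^ 4 = 1) (ρ a : V) :
    ∑' b, ENNReal.ofReal (s ^ 3) ^ G.dist a b * ENNReal.ofReal (s ^ 2) ^ G.dist ρ b ≤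
      ENNReal.ofReal ((1 - s ^ 6) / (1 - s) ^ 2) * ENNReal.ofReal (s ^ 2) ^ G.dist ρ a := by
  have hC : 0 ≤ (1 - s ^ 6) / (1 - s) ^ 2 := by
    have : s ^ 6 ≤ 1 := pow_le_one₀ hs.le hs1.le
    have : 0 ≤ 1 - s ^ 6 := by linarith
    positivity
  rw [ENNReal.tsum_eq_iSup_sum]
  refine iSup_le fun U => ?_
  rw [← ENNReal.ofReal_pow (by positivity), ← ENNReal.ofReal_mul hC]
  calc _ = ∑ u ∈ U, ENNReal.ofReal ((s ^ 3) ^ G.dist u a * (s ^ 2) ^ G.dist ρ u) := by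
        refine Finset.sum_congr rfl fun u _ => ?_
        rw [ENNReal.ofReal_mul (by positivity), ENNReal.ofReal_pow (by positivity : 0 ≤ s ^ 3),
          ENNReal.ofReal_pow (by positivity : 0 ≤ s ^ 2), SimpleGraph.dist_comm]
    _ = ENNReal.ofReal (∑ u ∈ U, (s ^ 3) ^ G.dist u a * (s ^ 2) ^ G.dist ρ u) :=
        (ENNReal.ofReal_sum_of_nonneg fun u _ => by positivity).symm
    _ ≤ _ := ENNReal.ofReal_le_ofReal
        (sum_pow_dist_mul_pow_dist_le hG hreg hs hs1 hds ρ U a)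

variable {Ω : Type*} [MeasurableSpace Ω] {P : Measure Ω} {π : Measure ℕ} {η : V → Ω → ℕ}
  {S : V → ℕ → Ω → ℕ → V}

lemma lintegral_particleCount_self [IsProbabilityMeasure P] (ρ : V) :
    ∫⁻ ω, (2 * particleCount ρ (fun v => η v ω) ρ : ℝ≥0∞) ^ (3 / 4 : ℝ) ∂P =
      2 ^ (3 / 4 : ℝ) := by
  simp [particleCount]

lemma IsFrogModel.lintegral_particleCount_of_ne [MeasurableSpace V]
    (h : IsFrogModel G π P η S) {ρ x : V} (hx : x ≠ ρ) :
    ∫⁻ ω, (2 * particleCount ρ (fun v => η v ω) x : ℝ≥0∞) ^ (3 / 4 : ℝ) ∂P =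
      ∫⁻ k : ℕ, (2 * k : ℝ≥0∞) ^ (3 / 4 : ℝ) ∂π := by
  simp only [particleCount, hx, if_false]
  rw [← h.law_count x, lintegral_map measurable_from_top (h.measurable_count x)]

variable [MeasurableSpace V] [DiscreteMeasurableSpace V] [Countable V] [IsProbabilityMeasure P]

/-- The probability that a given chain without repetitions carries activations from `ρ` back to
`ρ` is bounded by its weight. -/
lemma IsFrogModel.measure_chain_le (h : IsFrogModel G π P η S) (hG : G.IsTree)
    (hreg : G.IsRegularOfDegree (d + 1)) (hd : 2 ≤ d) {s : ℝ} (hs : 0 < s)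
    (hds : d * s ^ 4 = 1) (ρ : V) (l : List V) :
    P {ω | (ρ :: l).Nodup ∧
        (ρ :: l ++ [ρ]).IsChain (Reaches ρ (fun v => η v ω) (fun v i => S v i ω))} ≤
      2 ^ (3 / 4 : ℝ) * chainWeight (fun a b => ENNReal.ofReal (s ^ 3) ^ G.dist a b)
        (∫⁻ k : ℕ, (2 * k : ℝ≥0∞) ^ (3 / 4 : ℝ) ∂π) ρ ρ l := by
  classical
  by_cases hnd : (ρ :: l).Nodup
  swap
  · simp [hnd]
  obtain ⟨next, h1, h2⟩ := exists_next (fun a b => ENNReal.ofReal (s ^ 3) ^ G.dist a b)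
    (∫⁻ k : ℕ, (2 * k : ℝ≥0∞) ^ (3 / 4 : ℝ) ∂π) ρ l ρ hnd
  have hmono : {ω | (ρ :: l).Nodup ∧
        (ρ :: l ++ [ρ]).IsChain (Reaches ρ (fun v => η v ω) (fun v i => S v i ω))} ⊆
      {ω | ∀ x ∈ (ρ :: l).toFinset,
        Reaches ρ (fun v => η v ω) (fun v i => S v i ω) x (next x)} :=
    fun ω hω x hx => h1 _ hω.2 x (List.mem_toFinset.1 hx)
  refine (measure_mono hmono).trans
    ((h.measure_forall_reaches_le hG hreg hd hs hds ρ _ next).trans_eq ?_)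
  obtain ⟨hρ, hl⟩ := List.nodup_cons.1 hnd
  rw [Finset.prod_mul_distrib, ← h2, ← mul_assoc]
  congr 1
  rw [List.toFinset_cons, Finset.prod_insert (by simpa using hρ), lintegral_particleCount_self]
  congr 1
  rw [Finset.prod_congr rfl fun x hx => h.lintegral_particleCount_of_ne (ρ := ρ) (x := x) ?_,
    Finset.prod_const, List.toFinset_card_of_nodup hl]
  rintro rfl
  exact hρ (List.mem_toFinset.1 hx)

/-- The frog model is transient as soon as the moment of order `3 / 4` of the number of particles
per site is small enough. -/
theorem IsFrogModel.ae_isTransient (h : IsFrogModel G π P η S) (hG : G.IsTree)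
    (hreg : G.IsRegularOfDegree (d + 1)) (hd : 2 ≤ d) {s : ℝ} (hs : 0 < s) (hs1 : s < 1)
    (hds : d * s ^ 4 = 1)
    (hπ : (∫⁻ k : ℕ, (2 * k : ℝ≥0∞) ^ (3 / 4 : ℝ) ∂π) *
      ENNReal.ofReal ((1 - s ^ 6) / (1 - s) ^ 2) ≤ 2⁻¹) (ρ : V) :
    ∀ᵐ ω ∂P, IsTransient ρ (fun v => η v ω) (fun v i => S v i ω) := by
  have hsum : ∑' l : List V, P {ω | (ρ :: l).Nodup ∧
      (ρ :: l ++ [ρ]).IsChain (Reaches ρ (fun v => η v ω) (fun v i => S v i ω))} ≠ ∞ := by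
    refine ne_top_of_le_ne_top ?_
      (ENNReal.tsum_le_tsum fun l => h.measure_chain_le hG hreg hd hs hds ρ l)
    rw [ENNReal.tsum_mul_left]
    refine ENNReal.mul_ne_top (ENNReal.rpow_ne_top_of_nonneg (by norm_num) (by norm_num))
      (ne_top_of_le_ne_top ?_ (tsum_chainWeight_le
        (w := fun a => ENNReal.ofReal (s ^ 2) ^ G.dist ρ a)
        (fun a => tsum_pow_dist_mul_pow_dist_le hG hreg hs hs1 hds ρ a) (by simp) hπ ρ))
    rw [SimpleGraph.dist_self, pow_zero, mul_one]
    exact ENNReal.mul_ne_top (by norm_num) ENNReal.ofReal_ne_top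
  have hwalk : ∀ᵐ ω ∂P, ∀ v i, {t | S v i ω t = ρ}.Finite := by
    rw [ae_all_iff]
    intro v
    rw [ae_all_iff]
    intro i
    exact ae_finite_setOfPred_mem (s := fun t => {ω | S v i ω t = ρ}) (ne_top_of_le_ne_top
      ENNReal.ofReal_ne_top ((h.walk v i).tsum_measure_eq_le hG hreg hd hds ρ))
  filter_upwards [ae_finite_setOfPred_mem hsum, hwalk] with ω h1 h2
  exact isTransient_of_finite h1 h2

end FrogModel

namespace FrogModel

/-! ### The law of a sum of islands -/

lemma isProbabilityMeasure_islandLaw {μ : ℝ} {N : ℕ} (hμ : 0 ≤ μ) (hN : 0 < N) (h : μ ≤ N) :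
    IsProbabilityMeasure (islandLaw μ N) := by
  have hN' : (0 : ℝ) < N := by exact_mod_cast hN
  have : μ / N ≤ 1 := (div_le_one hN').2 h
  refine ⟨?_⟩
  simp only [islandLaw, Measure.coe_add, Measure.coe_smul, Pi.add_apply, Pi.smul_apply,
    measure_univ, smul_eq_mul, mul_one]
  rw [← ENNReal.ofReal_add (by positivity) (by linarith), add_sub_cancel, ENNReal.ofReal_one]

lemma lintegral_islandLaw (μ : ℝ) (N : ℕ) {f : ℕ → ℝ≥0∞} (hf : f 0 = 0) :
    ∫⁻ k, f k ∂islandLaw μ N = ENNReal.ofReal (μ / N) * f N := by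
  simp [islandLaw, lintegral_add_measure, lintegral_smul_measure, lintegral_dirac, hf]

lemma rpow_tsum_le_tsum_rpow (f : ℕ → ℝ≥0∞) {p : ℝ} (hp : 0 < p) (hp1 : p ≤ 1) :
    (∑' n, f n) ^ p ≤ ∑' n, f n ^ p := by
  have hfin : ∀ M, (∑ n ∈ Finset.range M, f n) ^ p ≤ ∑ n ∈ Finset.range M, f n ^ p := by
    intro M
    induction M with
    | zero => simp [hp]
    | succ M ih =>
      rw [Finset.sum_range_succ, Finset.sum_range_succ]
      exact (ENNReal.rpow_add_le_add_rpow _ _ hp.le hp1).trans (add_le_add_left ih _)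
  have hlim := ((ENNReal.continuous_rpow_const (y := p)).tendsto _).comp
    (ENNReal.tendsto_nat_tsum f)
  exact le_of_tendsto' hlim fun M => (hfin M).trans (ENNReal.sum_le_tsum _)

variable {ν : ℕ → Measure ℕ}

lemma measurable_tsum_natCast : Measurable fun x : ℕ → ℕ => ∑' n, (x n : ℝ≥0∞) :=
  Measurable.tsum fun n => measurable_from_top.comp (measurable_pi_apply n)

lemma lintegral_indepSumLaw {f : ℝ≥0∞ → ℝ≥0∞} (hf : Measurable f) :
    ∫⁻ y, f y ∂indepSumLaw ν =
      ∫⁻ x : ℕ → ℕ, f (∑' n, (x n : ℝ≥0∞)) ∂Measure.infinitePi ν :=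
  lintegral_map hf measurable_tsum_natCast

lemma lintegral_eq_of_map_eq {π : Measure ℕ} (h : π.map (fun k : ℕ => (k : ℝ≥0∞)) = indepSumLaw ν)
    {f : ℝ≥0∞ → ℝ≥0∞} (hf : Measurable f) :
    ∫⁻ k : ℕ, f k ∂π = ∫⁻ x : ℕ → ℕ, f (∑' n, (x n : ℝ≥0∞)) ∂Measure.infinitePi ν := by
  rw [← lintegral_indepSumLaw hf, ← h, lintegral_map hf measurable_from_top]

variable [∀ n, IsProbabilityMeasure (ν n)]

lemma lintegral_tsum_infinitePi (f : ℕ → ℝ≥0∞) :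
    ∫⁻ x : ℕ → ℕ, ∑' n, f (x n) ∂Measure.infinitePi ν = ∑' n, ∫⁻ k, f k ∂ν n := by
  rw [lintegral_tsum (f := fun n (x : ℕ → ℕ) => f (x n)) fun n =>
    (measurable_from_top.comp (measurable_pi_apply n)).aemeasurable]
  refine tsum_congr fun n => ?_
  exact (measurePreserving_eval_infinitePi ν n).lintegral_comp measurable_from_top

/-- By the Borel-Cantelli lemma, an independent sum whose terms vanish with summable exceptional
probabilities is almost surely a natural number. -/
lemma ae_indepSumLaw_eq_natCast (h : ∑' n, ν n {k | k ≠ 0} ≠ ∞) :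
    ∀ᵐ y ∂indepSumLaw ν, ((⌊y.toReal⌋₊ : ℕ) : ℝ≥0∞) = y := by
  have hms : MeasurableSet {y : ℝ≥0∞ | ((⌊y.toReal⌋₊ : ℕ) : ℝ≥0∞) = y} :=
    measurableSet_eq_fun (measurable_from_top.comp
      (Nat.measurable_floor.comp ENNReal.measurable_toReal)) measurable_id
  rw [indepSumLaw, ae_map_iff measurable_tsum_natCast.aemeasurable hms]
  have hsum : ∑' n, Measure.infinitePi ν {x : ℕ → ℕ | x n ≠ 0} ≠ ∞ := by
    convert h using 3 with n
    exact (measurePreserving_eval_infinitePi ν n).measure_preimage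
      (MeasurableSet.of_discrete (s := {k : ℕ | k ≠ 0})).nullMeasurableSet
  filter_upwards [ae_finite_setOfPred_mem hsum] with x hx
  have hfin : ∑' n, (x n : ℝ≥0∞) = ((∑ n ∈ hx.toFinset, x n : ℕ) : ℝ≥0∞) := by
    rw [tsum_eq_sum (s := hx.toFinset)]
    · push_cast
      rfl
    · intro n hn
      simpa using hn
  rw [hfin, ENNReal.toReal_natCast, Nat.floor_natCast]

/-- An independent sum whose terms vanish with summable exceptional probabilities has a law on the
natural numbers. -/
lemma exists_natLaw_of_indepSumLaw (h : ∑' n, ν n {k | k ≠ 0} ≠ ∞) :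
    ∃ π : Measure ℕ, IsProbabilityMeasure π ∧
      π.map (fun k : ℕ => (k : ℝ≥0∞)) = indepSumLaw ν := by
  have hfl : Measurable fun y : ℝ≥0∞ => ⌊y.toReal⌋₊ :=
    Nat.measurable_floor.comp ENNReal.measurable_toReal
  have hprob : IsProbabilityMeasure (indepSumLaw ν) :=
    Measure.isProbabilityMeasure_map measurable_tsum_natCast.aemeasurable
  refine ⟨(indepSumLaw ν).map fun y => ⌊y.toReal⌋₊,
    Measure.isProbabilityMeasure_map hfl.aemeasurable, ?_⟩
  rw [Measure.map_map measurable_from_top hfl]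
  conv_rhs => rw [← Measure.map_id (μ := indepSumLaw ν)]
  exact Measure.map_congr (ae_indepSumLaw_eq_natCast h)

/-- Islands `N n` can be chosen so sparse that their moments of order `3 / 4` are summable with
sum at most `ε`, since `(μ / N) N ^ (3 / 4)` tends to zero. -/
lemma exists_sparse_islands (μ : ℝ) {ε : ℝ≥0∞} (hε : ε ≠ 0) :
    ∃ N : ℕ → ℕ, (∀ n, 0 < N n ∧ μ ≤ N n) ∧
      ∑' n, ENNReal.ofReal (μ / N n) * (2 * N n : ℝ≥0∞) ^ (3 / 4 : ℝ) ≤ ε := by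
  obtain ⟨δ, hδ, hδε⟩ := ENNReal.exists_pos_sum_of_countable' hε ℕ
  have hlim : Filter.Tendsto (fun N : ℕ => ENNReal.ofReal (μ / N) *
      (2 * N : ℝ≥0∞) ^ (3 / 4 : ℝ)) Filter.atTop (nhds 0) := by
    have h1 : Filter.Tendsto (fun N : ℕ => ENNReal.ofReal
        (μ * 2 ^ (3 / 4 : ℝ) * (N : ℝ) ^ (-(1 / 4 : ℝ)))) Filter.atTop (nhds 0) := by
      rw [← ENNReal.ofReal_zero]
      refine ENNReal.tendsto_ofReal ?_
      rw [← mul_zero (μ * 2 ^ (3 / 4 : ℝ))]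
      exact ((tendsto_rpow_neg_atTop (by norm_num)).comp
        tendsto_natCast_atTop_atTop).const_mul _
    refine h1.congr' ?_
    filter_upwards [Filter.eventually_gt_atTop 0] with N hN
    have hN' : (0 : ℝ) < N := by exact_mod_cast hN
    have h2 : (2 * N : ℝ≥0∞) ^ (3 / 4 : ℝ) = ENNReal.ofReal ((2 * N : ℝ) ^ (3 / 4 : ℝ)) := by
      rw [← ENNReal.ofReal_rpow_of_nonneg (by positivity) (by norm_num),
        ENNReal.ofReal_mul (by norm_num), ENNReal.ofReal_ofNat, ENNReal.ofReal_natCast]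
    rw [h2, ← ENNReal.ofReal_mul' (by positivity), Real.mul_rpow (by norm_num) hN'.le]
    congr 1
    rw [show (-(1 / 4 : ℝ)) = 3 / 4 - 1 by norm_num, Real.rpow_sub hN', Real.rpow_one]
    ring
  have hex : ∀ n, ∃ N : ℕ, (0 < N ∧ μ ≤ N) ∧
      ENNReal.ofReal (μ / N) * (2 * N : ℝ≥0∞) ^ (3 / 4 : ℝ) < δ n := fun n =>
    (((Filter.eventually_gt_atTop 0).and
      (tendsto_natCast_atTop_atTop.eventually_ge_atTop μ)).and
        (hlim.eventually_lt_const (hδ n))).exists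
  choose N hN hNδ using hex
  exact ⟨N, hN, (ENNReal.tsum_le_tsum fun n => (hNδ n).le).trans hδε.le⟩

end FrogModel

open FrogModel in
theorem mainTheorem3 (d : ℕ) (hd : 2 ≤ d) (μ : ℝ) (hμ : 0 < μ)
    {V : Type*} [MeasurableSpace V] [DiscreteMeasurableSpace V]
    (G : SimpleGraph V) [G.LocallyFinite] (hG : G.IsTree)
    (hreg : G.IsRegularOfDegree (d + 1)) :
    ∃ (N : ℕ → ℕ) (π : Measure ℕ),
      (∀ n, 0 < N n ∧ μ ≤ N n) ∧
      IsProbabilityMeasure π ∧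
      π.map (fun k : ℕ => (k : ℝ≥0∞)) =
        FrogModel.indepSumLaw (fun n => FrogModel.islandLaw μ (N n)) ∧
      ∫⁻ k : ℕ, (k : ℝ≥0∞) ∂π = ∞ ∧
      ∀ (ρ : V) {Ω : Type*} [MeasurableSpace Ω] (P : Measure Ω) [IsProbabilityMeasure P]
        (η : V → Ω → ℕ) (S : V → ℕ → Ω → ℕ → V), FrogModel.IsFrogModel G π P η S →
        ∀ᵐ ω ∂P, FrogModel.IsTransient ρ (fun v => η v ω) (fun v i => S v i ω) := by
  have : Countable V := countable_of_connected hG.connected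
  have hd' : (1 : ℝ) < d := by exact_mod_cast hd
  obtain ⟨s, hs, hs1, hds⟩ : ∃ s : ℝ, 0 < s ∧ s < 1 ∧ d * s ^ 4 = 1 := by
    refine ⟨(d : ℝ) ^ (-(1 / 4 : ℝ)), by positivity,
      Real.rpow_lt_one_of_one_lt_of_neg hd' (by norm_num), ?_⟩
    rw [← Real.rpow_natCast, ← Real.rpow_mul (by positivity)]
    norm_num
    rw [Real.rpow_neg_one]
    field_simp
  set C := ENNReal.ofReal ((1 - s ^ 6) / (1 - s) ^ 2) with hC
  have hε : (2⁻¹ / C : ℝ≥0∞) ≠ 0 := ENNReal.div_ne_zero.2 ⟨by norm_num, ENNReal.ofReal_ne_top⟩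
  -- The bound by `1` serves the Borel-Cantelli lemma, the bound by `2⁻¹ / C` serves transience.
  obtain ⟨N, hN, hsum⟩ := exists_sparse_islands μ (lt_min one_pos (pos_iff_ne_zero.2 hε)).ne'
  have hprob : ∀ n, IsProbabilityMeasure (islandLaw μ (N n)) := fun n =>
    isProbabilityMeasure_islandLaw hμ.le (hN n).1 (hN n).2
  have hbc : ∑' n, islandLaw μ (N n) {k | k ≠ 0} ≠ ∞ := by
    refine ne_top_of_le_ne_top ENNReal.one_ne_top
      (le_trans (ENNReal.tsum_le_tsum fun n => ?_) (hsum.trans (min_le_left _ _)))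
    rw [← lintegral_indicator_one MeasurableSet.of_discrete, lintegral_islandLaw _ _ (by simp)]
    gcongr
    refine (Set.indicator_le_self' (by simp) _).trans ?_
    refine ENNReal.one_le_rpow ?_ (by norm_num)
    have : (1 : ℝ≥0∞) ≤ N n := by exact_mod_cast (hN n).1
    calc (1 : ℝ≥0∞) ≤ N n := this
      _ ≤ 2 * N n := le_mul_of_one_le_left (by simp) (by norm_num)
  obtain ⟨π, hπ, hmap⟩ := exists_natLaw_of_indepSumLaw hbc
  refine ⟨N, π, hN, hπ, hmap, ?_, fun ρ Ω _ P _ η S h => ?_⟩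
  · have := lintegral_eq_of_map_eq hmap measurable_id
    simp only [id] at this
    rw [this, lintegral_tsum_infinitePi (fun k => k)]
    have hmean : ∀ n, ∫⁻ k : ℕ, (k : ℝ≥0∞) ∂islandLaw μ (N n) = ENNReal.ofReal μ := by
      intro n
      have hNn : (0 : ℝ) < N n := by exact_mod_cast (hN n).1
      rw [lintegral_islandLaw _ _ (by simp), ← ENNReal.ofReal_natCast,
        ← ENNReal.ofReal_mul (by positivity), div_mul_cancel₀ _ hNn.ne']
    simp only [hmean]
    exact ENNReal.tsum_const_eq_top_of_ne_zero (by simpa using hμ)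
  · refine h.ae_isTransient hG hreg hd hs hs1 hds ?_ ρ
    have hf : Measurable fun y : ℝ≥0∞ => (2 * y) ^ (3 / 4 : ℝ) := by fun_prop
    have hmoment : ∫⁻ k : ℕ, (2 * k : ℝ≥0∞) ^ (3 / 4 : ℝ) ∂π ≤ 2⁻¹ / C := by
      rw [lintegral_eq_of_map_eq hmap hf]
      calc _ ≤ ∫⁻ x : ℕ → ℕ, ∑' n, (2 * x n : ℝ≥0∞) ^ (3 / 4 : ℝ)
              ∂Measure.infinitePi fun n => islandLaw μ (N n) := by
            refine lintegral_mono fun x => ?_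
            rw [← ENNReal.tsum_mul_left]
            exact rpow_tsum_le_tsum_rpow _ (by norm_num) (by norm_num)
        _ = ∑' n, ENNReal.ofReal (μ / N n) * (2 * N n : ℝ≥0∞) ^ (3 / 4 : ℝ) := by
            rw [lintegral_tsum_infinitePi fun k => (2 * k : ℝ≥0∞) ^ (3 / 4 : ℝ)]
            exact tsum_congr fun n => lintegral_islandLaw _ _ (by norm_num)
        _ ≤ _ := hsum.trans (min_le_right _ _)
    exact ENNReal.mul_le_of_le_div hmoment
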